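/- Theorem 3 (Moments). For $i=1,2$ let $0<\omega_i<1$, $\lambda_i,a_i,b_i,c_i>0$, and let $I_1,I_2$ be independent random variables on a probability space, $I_i$ having the mixture Exponential–Generalized Gamma density $$f_{I_i}(x)=\frac{\omega_i}{\lambda_i}e^{-x/\lambda_i}+(1-\omega_i)\frac{c_i\,x^{a_ic_i-1}}{b_i^{a_ic_i}\Gamma(a_i)}e^{-(x/b_i)^{c_i}},\qquad x>0 .$$ Let $r_1,r_2\in\{1,2\}$, $\eta,N_{0_1},N_{0_2},C>0$, and put $$\gamma_i=\frac{(\eta I_i)^{r_i}}{N_{0_i}},\qquad \mu_{r_i}=\frac{\eta^{r_i}}{N_{0_i}},\qquad \gamma=\frac{\gamma_1\gamma_2}{\gamma_2+C}.$$ Then $\mu_{r_i}$ is the average electrical SNR of the $i$-th hop: if $r_i=1$ and $\mathbb E[I_i]=1$ (normalized fading) then $\mu_{r_i}=\mathbb E[\gamma_i]$, and if $r_i=2$ then $\mu_{r_i}=\mathbb E[\gamma_i]\big/\big(2\omega_i\lambda_i^2+b_i^2(1-\omega_i)\Gamma(a_i+2/c_i)/\Gamma(a_i)\big)$. Moreover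 $\gamma$ has a density $f_\gamma$, and for every integer $n\ge 1$ the moment $\mathbb E[\gamma^n]=\int_0^\infty x^n f_\gamma(x)\,dx$ is finite and $$\begin{aligned}\mathbb E[\gamma^n]={}&\left(\frac{\omega_1\omega_2}{\Gamma(n)}\Gamma(1+r_1n)(\lambda_1^{r_1}\mu_{r_1})^n+\frac{\omega_2(1-\omega_1)(b_1^{r_1}\mu_{r_1})^n}{\Gamma(a_1)\Gamma(n)}\Gamma\!\left(a_1+\frac{r_1n}{c_1}\right)\right)\mathrm H^{2,1}_{1,2}\!\left[\frac{C}{\lambda_2^{r_2}\mu_{r_2}}\,\middle|\,\begin{matrix}(1-n,1)\\(0,1),(1,r_2)\end{matrix}\right]\\&+\left(\frac{\omega_1(1-\omega_2)\Gamma(1+r_1n)(\lambda_1^{r_1}\mu_{r_1})^n}{\Gamma(a_2)\Gamma(n)}+\frac{(1-\omega_1)(1-\omega_2)(b_1^{r_1}\mu_{r_1})^n}{\Gamma(a_1)\Gamma(a_2)\Gamma(n)}\Gamma\!\left(a_1+\frac{r_1}{c_1}n\right)\right)\mathrm H^{2,1}_{1,2}\!\left[\frac{C}{b_2^{r_2}\mu_{r_2}}\,\middle|\,\begin{matrix}(1-n,1)\\(0,1),(a_2,\frac{r_2}{c_2})\end{matrix}\right].\end{aligned}$$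 Here Fox's H-function is the Mellin–Barnes integral $$\mathrm H^{m,k}_{p,q}\!\left[z\,\middle|\,\begin{matrix}(\alpha_1,A_1),\dots,(\alpha_p,A_p)\\(\beta_1,B_1),\dots,(\beta_q,B_q)\end{matrix}\right]=\frac1{2\pi i}\int_{\sigma-i\infty}^{\sigma+i\infty}\frac{\prod_{j\le m}\Gamma(\beta_j+B_js)\prod_{i\le k}\Gamma(1-\alpha_i-A_is)}{\prod_{j>m}\Gamma(1-\beta_j-B_js)\prod_{i>k}\Gamma(\alpha_i+A_is)}\,z^{-s}\,ds$$ along a vertical line separating the poles of the factors $\Gamma(\beta_j+B_js)$, $j\le m$, from those of the factors $\Gamma(1-\alpha_i-A_is)$, $i\le k$; for the two functions above such lines exist, and on each of them the integral converges absolutely, to a value that does not depend on the line. -/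

import Mathlib

open MeasureTheory ProbabilityTheory

/-! ### Fox's H-function of one variable -/

/-- The Mellin--Barnes kernel of `H^{m,n}_{p,q}` with upper parameters `(a i).1, (a i).2` and lower
parameters `(b j).1, (b j).2`:
`∏_{j ≤ m} Γ(b_j + B_j s) ∏_{i ≤ n} Γ(1 - a_i - A_i s)` divided by
`∏_{j > m} Γ(1 - b_j - B_j s) ∏_{i > n} Γ(a_i + A_i s)`.
Indices in `Fin` start at `0`, so "the first `m`" reads `j < m`. -/
noncomputable def foxHKernel {p q : ℕ} (m n : ℕ) (a : Fin p → ℂ × ℝ) (b : Fin q → ℂ × ℝ)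
    (s : ℂ) : ℂ :=
  (∏ j : Fin q, if (j : ℕ) < m then Complex.Gamma ((b j).1 + (b j).2 * s) else 1) *
    (∏ i : Fin p, if (i : ℕ) < n then Complex.Gamma (1 - (a i).1 - (a i).2 * s) else 1) /
  ((∏ j : Fin q, if (j : ℕ) < m then 1 else Complex.Gamma (1 - (b j).1 - (b j).2 * s)) *
    (∏ i : Fin p, if (i : ℕ) < n then 1 else Complex.Gamma ((a i).1 + (a i).2 * s)))

/-- The vertical line `Re s = σ` separates the poles `s = -(b_j + k) / B_j` of the factors
`Γ(b_j + B_j s)`, `j ≤ m` (to its left), from the poles `s = (1 - a_i + k) / A_i` of the factors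
`Γ(1 - a_i - A_i s)`, `i ≤ n` (to its right). -/
def FoxHSeparates {p q : ℕ} (m n : ℕ) (a : Fin p → ℂ × ℝ) (b : Fin q → ℂ × ℝ) (σ : ℝ) : Prop :=
  (∀ j : Fin q, (j : ℕ) < m → ∀ k : ℕ, (-((b j).1 + k) / ((b j).2 : ℂ)).re < σ) ∧
  (∀ i : Fin p, (i : ℕ) < n → ∀ k : ℕ, σ < ((1 - (a i).1 + k) / ((a i).2 : ℂ)).re)

/-- The Mellin--Barnes integrand at the point `σ + i t`. -/
noncomputable def foxHIntegrand {p q : ℕ} (m n : ℕ) (a : Fin p → ℂ × ℝ) (b : Fin q → ℂ × ℝ)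
    (z : ℂ) (σ t : ℝ) : ℂ :=
  z ^ (-((σ : ℂ) + t * Complex.I)) * foxHKernel m n a b ((σ : ℂ) + t * Complex.I)

/-- `(1 / 2πi) ∫_{σ - i∞}^{σ + i∞}` of the Mellin--Barnes integrand, parametrized by
`s = σ + i t`, `ds = i dt`. -/
noncomputable def foxHLine {p q : ℕ} (m n : ℕ) (a : Fin p → ℂ × ℝ) (b : Fin q → ℂ × ℝ)
    (z : ℂ) (σ : ℝ) : ℂ :=
  (1 / (2 * Real.pi) : ℂ) * ∫ t : ℝ, foxHIntegrand m n a b z σ t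

open Classical in
/-- Fox's H-function `H^{m,n}_{p,q}[z | a; b]` as a Mellin--Barnes integral along a vertical line
that separates the two families of poles (value `0` if there is no such line). -/
noncomputable def foxH {p q : ℕ} (m n : ℕ) (a : Fin p → ℂ × ℝ) (b : Fin q → ℂ × ℝ) (z : ℂ) : ℂ :=
  if h : ∃ σ : ℝ, FoxHSeparates m n a b σ then foxHLine m n a b z h.choose else 0

/-- `H^{m,n}_{p,q}[z | a; b]` is well defined: there is a separating vertical line, and on every
such line the Mellin--Barnes integral converges absolutely, to the same value. -/
def FoxHWellDefined {p q : ℕ} (m n : ℕ) (a : Fin p → ℂ × ℝ) (b : Fin q → ℂ × ℝ) (z : ℂ) : Prop :=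
  (∃ σ : ℝ, FoxHSeparates m n a b σ) ∧
  ∀ σ : ℝ, FoxHSeparates m n a b σ →
    Integrable (foxHIntegrand m n a b z σ) ∧ foxHLine m n a b z σ = foxH m n a b z

/-! ### The mixture Exponential-Generalized Gamma (EGG) distribution -/

/-- Parameters of the mixture EGG distribution: the weight `w`, the parameter `lam` of the
exponential component, and the parameters `a, b, c` of the generalized Gamma component. -/
structure EGGParams where
  w : ℝ
  lam : ℝ
  a : ℝ
  b : ℝ
  c : ℝ
  w_pos : 0 < w
  w_lt_one : w < 1
  lam_pos : 0 < lam
  a_pos : 0 < a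
  b_pos : 0 < b
  c_pos : 0 < c

/-- The density of the mixture EGG distribution, supported on `(0, ∞)`. -/
noncomputable def eggPDF (p : EGGParams) (x : ℝ) : ℝ :=
  if 0 < x then
    p.w / p.lam * Real.exp (-(x / p.lam)) +
      (1 - p.w) * (p.c * x ^ (p.a * p.c - 1) / (p.b ^ (p.a * p.c) * Real.Gamma p.a)) *
        Real.exp (-((x / p.b) ^ p.c))
  else 0

/-- The mixture EGG distribution. -/
noncomputable def eggMeasure (p : EGGParams) : Measure ℝ :=
  volume.withDensity fun x => ENNReal.ofReal (eggPDF p x)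

/-! ### The dual-hop system -/

/-- Instantaneous SNR `(η I)^r / N₀` of a hop with irradiance `I`. -/
noncomputable def hopSNR (η N₀ : ℝ) (r : ℕ) (I : ℝ) : ℝ := (η * I) ^ r / N₀

/-- Electrical SNR `μ_r = η^r / N₀` of a hop (the SNR at unit irradiance). -/
noncomputable def electricalSNR (η N₀ : ℝ) (r : ℕ) : ℝ := η ^ r / N₀

/-- End-to-end SNR of a fixed gain relay with relay constant `C`. -/
noncomputable def endToEndSNR (C g₁ g₂ : ℝ) : ℝ := g₁ * g₂ / (g₂ + C)

/-- `μ` is the average electrical SNR expressed through the average SNR `gbar = E[γ_i]` of a hop and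
the mean irradiance `Ibar`: for `r = 2`, `μ = gbar / (2 ω λ² + (1 - ω) b² Γ(a + 2/c) / Γ(a))`; for
`r = 1` and normalized fading (`Ibar = 1`), `μ = gbar`. -/
def IsAverageElectricalSNR (p : EGGParams) (r : ℕ) (Ibar gbar μ : ℝ) : Prop :=
  (r = 1 → Ibar = 1 → μ = gbar) ∧
  (r = 2 → μ = gbar / (2 * p.w * p.lam ^ 2 +
    p.b ^ 2 * (1 - p.w) * Real.Gamma (p.a + 2 / p.c) / Real.Gamma p.a))

/-!
The end-to-end SNR is `γ = γ₁ * g(γ₂)` with the bounded gain `g(x) = x / (x + C)`, so by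
independence `E[γ ^ ν] = E[γ₁ ^ ν] * E[g(γ₂) ^ ν]`. Each component of the EGG mixture is the law of
a scaled power of a Gamma variable, which turns the first factor into values of `Γ`. In the second
factor `g(γ₂) ^ ν = (1 + C / γ₂) ^ (-ν)`, and Ramanujan's integral
`Γ(ν) (1 + z) ^ (-ν) = (1 / 2πi) ∫ Γ(s) Γ(ν - s) z ^ (-s) ds`, itself a consequence of the
Cahen–Mellin integral for `exp (-x)`, makes it the Gamma average of a Mellin–Barnes integral;
exchanging the two integrals inserts a factor `Γ(a + B s)` into the kernel, which is then that of
`H^{2,1}_{1,2}`. Finally, `γ` has a density because `γ₁` has one and is multiplied by an independent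
nonzero variable.
-/

section GammaOnVerticalLines

open Complex Set

theorem norm_Gamma_le_Gamma_re {s : ℂ} (hs : 0 < s.re) : ‖Gamma s‖ ≤ Real.Gamma s.re := by
  rw [Gamma_eq_integral hs, Real.Gamma_eq_integral hs, GammaIntegral]
  refine (norm_integral_le_integral_norm _).trans_eq ?_
  refine setIntegral_congr_fun measurableSet_Ioi fun x hx => ?_
  simp only [norm_mul, norm_cpow_eq_rpow_re_of_pos hx, sub_re, one_re]
  rw [Complex.norm_of_nonneg (Real.exp_pos _).le]

theorem continuous_Gamma_comp {X : Type*} [TopologicalSpace X] {f : X → ℂ}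
    (hf : Continuous f) (hre : ∀ x, 0 < (f x).re) : Continuous fun x => Gamma (f x) := by
  refine continuous_iff_continuousAt.2 fun x => ?_
  refine (continuousAt_Gamma (f x) fun m hm => ?_).comp hf.continuousAt
  have hx := hre x
  rw [hm, neg_re, natCast_re] at hx
  linarith [m.cast_nonneg (α := ℝ)]

theorem norm_Gamma_mul_norm_sq_le {s : ℂ} (hs : 0 < s.re) :
    ‖Gamma s‖ * ‖s‖ ^ 2 ≤ Real.Gamma (s.re + 2) := by
  have hs₀ : s ≠ 0 := fun h => by simp [h] at hs
  have hs₁ : s + 1 ≠ 0 := fun h => by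
    have := congrArg re h
    rw [add_re, one_re, zero_re] at this
    linarith
  have hrec : Gamma (s + 2) = Gamma s * ((s + 1) * s) := by
    rw [show s + 2 = s + 1 + 1 by ring, Gamma_add_one _ hs₁, Gamma_add_one _ hs₀]
    ring
  have hnorm : ‖s‖ ≤ ‖s + 1‖ := by
    refine le_of_sq_le_sq ?_ (norm_nonneg _)
    simp only [Complex.sq_norm, normSq_apply, add_re, add_im, one_re, one_im]
    nlinarith
  calc ‖Gamma s‖ * ‖s‖ ^ 2 ≤ ‖Gamma s‖ * (‖s + 1‖ * ‖s‖) := by rw [sq]; gcongr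
    _ = ‖Gamma (s + 2)‖ := by rw [hrec, norm_mul, norm_mul]
    _ ≤ Real.Gamma (s.re + 2) := by
      simpa using norm_Gamma_le_Gamma_re (s := s + 2) (by simpa using by linarith)

theorem verticalIntegrable_Gamma {σ : ℝ} (hσ : 0 < σ) : VerticalIntegrable Gamma σ := by
  have hcont : Continuous fun t : ℝ => Gamma (σ + t * I) :=
    continuous_Gamma_comp (by fun_prop) (by simpa)
  have hint : Integrable fun t : ℝ => Real.Gamma (σ + 2) * (σ ^ 2)⁻¹ * (1 + (σ⁻¹ * t) ^ 2)⁻¹ :=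
    (integrable_inv_one_add_sq.comp_mul_left' (inv_ne_zero hσ.ne')).const_mul _
  refine hint.mono' hcont.aestronglyMeasurable (Filter.Eventually.of_forall fun t => ?_)
  have hsq : ‖(σ + t * I : ℂ)‖ ^ 2 = σ ^ 2 * (1 + (σ⁻¹ * t) ^ 2) := by
    rw [Complex.sq_norm, normSq_add_mul_I]
    field_simp
  have hle := norm_Gamma_mul_norm_sq_le (s := σ + t * I) (by simpa)
  rw [hsq, show (σ + t * I : ℂ).re = σ by simp] at hle
  rwa [mul_assoc, ← mul_inv, ← div_eq_mul_inv, le_div_iff₀ (by positivity)]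

end GammaOnVerticalLines

section MellinBarnes

open Complex Set

theorem mellinInv_Gamma {σ x : ℝ} (hσ : 0 < σ) (hx : 0 < x) :
    mellinInv σ Gamma x = Real.exp (-x) := by
  set f : ℝ → ℂ := fun x => (Real.exp (-x) : ℂ)
  have hmellin (t : ℝ) : mellin f (σ + t * I) = Gamma (σ + t * I) := by
    rw [Gamma_eq_integral (by simpa), GammaIntegral_eq_mellin]
  have hconv : MellinConvergent f σ := by
    refine (GammaIntegral_convergent (s := σ) (by simpa)).congr_fun (fun x _ => ?_)
      measurableSet_Ioi
    simp [f, mul_comm]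
  have hvert : VerticalIntegrable (mellin f) σ := by
    simpa only [VerticalIntegrable, hmellin] using verticalIntegrable_Gamma hσ
  have hinv := mellinInv_mellin_eq σ f hx hconv hvert (by fun_prop)
  simpa only [mellinInv, hmellin] using hinv

theorem integrable_cpow_mul {K : ℂ → ℂ} {σ z : ℝ} (hK : VerticalIntegrable K σ) (hz : 0 < z) :
    Integrable fun t : ℝ => (z : ℂ) ^ (-(σ + t * I)) * K (σ + t * I) := by
  refine hK.bdd_mul (c := z ^ (-σ)) ?_ (Filter.Eventually.of_forall fun t => ?_)
  · exact (Measurable.pow (by fun_prop) (by fun_prop)).aestronglyMeasurable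
  · simp [norm_cpow_eq_rpow_re_of_pos hz]

theorem verticalIntegrable_mul_Gamma {K : ℂ → ℂ} {σ β : ℝ} {a : ℂ}
    (hK : VerticalIntegrable K σ) (hσ : 0 < a.re + β * σ) :
    VerticalIntegrable (fun s => K s * Gamma (a + β * s)) σ := by
  have hre (t : ℝ) : (a + β * (σ + t * I)).re = a.re + β * σ := by simp
  refine Integrable.mul_bdd (c := Real.Gamma (a.re + β * σ)) hK ?_
    (Filter.Eventually.of_forall fun t => ?_)
  · exact (continuous_Gamma_comp (by fun_prop) fun t => by rwa [hre]).aestronglyMeasurable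
  · simpa only [hre] using norm_Gamma_le_Gamma_re (hσ.trans_eq (hre t).symm)

theorem exp_mul_cpow_mul_cpow_neg {x z : ℝ} (hx : 0 < x) (hz : 0 < z) (β : ℝ) (a s : ℂ) :
    Real.exp (-x) * (x : ℂ) ^ (a + β * s - 1) * (z : ℂ) ^ (-s) =
      (x : ℂ) ^ (a - 1) * Real.exp (-x) * ((z * x ^ (-β) : ℝ) : ℂ) ^ (-s) := by
  have hpow : ((x ^ (-β) : ℝ) : ℂ) ^ (-s) = (x : ℂ) ^ (β * s) := by
    rw [← cpow_mul_ofReal_nonneg hx.le]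
    congr 1
    push_cast
    ring
  rw [ofReal_mul z, mul_cpow_ofReal_nonneg hz.le (by positivity), hpow,
    show a + β * s - 1 = (a - 1) + β * s by ring, cpow_add _ _ (ofReal_ne_zero.2 hx.ne')]
  ring

theorem integrable_exp_mul_cpow_prod {k : ℝ → ℂ} (hk : Integrable k) {σ β : ℝ} {a : ℂ}
    (hσ : 0 < a.re + β * σ) :
    Integrable (fun p : ℝ × ℝ =>
        (Real.exp (-p.1) * (p.1 : ℂ) ^ (a + β * (σ + p.2 * I) - 1)) * k p.2)
      ((volume.restrict (Ioi 0)).prod volume) := by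
  refine ((Real.GammaIntegral_convergent hσ).mul_prod hk.norm).mono' ?_ ?_
  · refine AEStronglyMeasurable.mul (Measurable.aestronglyMeasurable ?_)
      hk.aestronglyMeasurable.comp_snd
    exact (by fun_prop : Measurable fun p : ℝ × ℝ => (Real.exp (-p.1) : ℂ)).mul
      (Measurable.pow (by fun_prop) (by fun_prop))
  · have hpos : ∀ᵐ p : ℝ × ℝ ∂(volume.restrict (Ioi 0)).prod volume, 0 < p.1 :=
      Measure.quasiMeasurePreserving_fst.ae (ae_restrict_mem measurableSet_Ioi)
    filter_upwards [hpos] with p hp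
    rw [norm_mul, norm_mul, norm_cpow_eq_rpow_re_of_pos hp,
      Complex.norm_of_nonneg (Real.exp_pos _).le]
    simp

-- Substituting Euler's integral for the factor `Γ(a + β s)` and exchanging the two integrals.
theorem mellinInv_mul_Gamma {K : ℂ → ℂ} {σ β z : ℝ} {a : ℂ} (hK : VerticalIntegrable K σ)
    (hσ : 0 < a.re + β * σ) (hz : 0 < z) :
    mellinInv σ (fun s => K s * Gamma (a + β * s)) z =
      ∫ x in Ioi (0 : ℝ), (x : ℂ) ^ (a - 1) * Real.exp (-x) * mellinInv σ K (z * x ^ (-β)) := by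
  have hEuler (t : ℝ) : (z : ℂ) ^ (-(σ + t * I)) * (K (σ + t * I) * Gamma (a + β * (σ + t * I))) =
      ∫ x in Ioi (0 : ℝ), Real.exp (-x) * (x : ℂ) ^ (a + β * (σ + t * I) - 1) *
        ((z : ℂ) ^ (-(σ + t * I)) * K (σ + t * I)) := by
    rw [integral_mul_const, Gamma_eq_integral (by simpa), GammaIntegral]
    ring
  have hline {x : ℝ} (hx : 0 < x) :
      ∫ t : ℝ, Real.exp (-x) * (x : ℂ) ^ (a + β * (σ + t * I) - 1) *
        ((z : ℂ) ^ (-(σ + t * I)) * K (σ + t * I)) =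
      (x : ℂ) ^ (a - 1) * Real.exp (-x) *
        ∫ t : ℝ, ((z * x ^ (-β) : ℝ) : ℂ) ^ (-(σ + t * I)) * K (σ + t * I) := by
    rw [← integral_const_mul]
    refine integral_congr_ae (Filter.Eventually.of_forall fun t => ?_)
    beta_reduce
    rw [← mul_assoc, exp_mul_cpow_mul_cpow_neg hx hz, mul_assoc]
  simp only [mellinInv, smul_eq_mul, hEuler, mul_smul_comm, integral_smul]
  rw [← integral_integral_swap (integrable_exp_mul_cpow_prod (integrable_cpow_mul hK hz) hσ)]
  exact congrArg _ (setIntegral_congr_fun measurableSet_Ioi fun x hx => hline hx)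

theorem verticalIntegrable_Gamma_mul_Gamma_sub {σ : ℝ} {ν : ℂ} (hσ : 0 < σ) (hν : σ < ν.re) :
    VerticalIntegrable (fun s => Gamma s * Gamma (ν - s)) σ := by
  have h := verticalIntegrable_mul_Gamma (a := ν) (β := -1) (verticalIntegrable_Gamma hσ)
    (by linarith)
  simpa only [ofReal_neg, ofReal_one, neg_one_mul, ← sub_eq_add_neg] using h

theorem mellinInv_Gamma_mul_Gamma_sub {σ z : ℝ} {ν : ℂ} (hσ : 0 < σ) (hν : σ < ν.re)
    (hz : 0 < z) :
    mellinInv σ (fun s => Gamma s * Gamma (ν - s)) z = Gamma ν * ((1 + z : ℝ) : ℂ) ^ (-ν) := by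
  have h := mellinInv_mul_Gamma (a := ν) (β := -1) (verticalIntegrable_Gamma hσ) (by linarith) hz
  simp only [ofReal_neg, ofReal_one, neg_one_mul, ← sub_eq_add_neg, neg_neg, Real.rpow_one] at h
  have harg : ((1 + z : ℝ) : ℂ).arg ≠ Real.pi := by
    rw [arg_ofReal_of_nonneg (by positivity)]
    exact Real.pi_ne_zero.symm
  rw [h, mul_comm, cpow_neg, ← inv_cpow _ _ harg, ← one_div,
    ← integral_cpow_mul_exp_neg_mul_Ioi (hσ.trans hν) (by positivity)]
  refine setIntegral_congr_fun measurableSet_Ioi fun x (hx : 0 < x) => ?_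
  rw [mellinInv_Gamma hσ (by positivity), mul_assoc, ← ofReal_mul, ← Real.exp_add]
  push_cast
  ring_nf

end MellinBarnes

section FoxH

open Complex Set

theorem foxHLine_eq_mellinInv {p q : ℕ} (m n : ℕ) (a : Fin p → ℂ × ℝ) (b : Fin q → ℂ × ℝ)
    (z σ : ℝ) : foxHLine m n a b z σ = mellinInv σ (foxHKernel m n a b) z := by
  simp [foxHLine, mellinInv, foxHIntegrand]

theorem foxH_eq_of_mellinInv_eq {p q m n : ℕ} {a : Fin p → ℂ × ℝ} {b : Fin q → ℂ × ℝ} {z : ℝ}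
    {v : ℂ} (hex : ∃ σ, FoxHSeparates m n a b σ)
    (hv : ∀ σ, FoxHSeparates m n a b σ → mellinInv σ (foxHKernel m n a b) z = v) :
    foxH m n a b z = v := by
  rw [foxH, dif_pos hex, foxHLine_eq_mellinInv, hv _ hex.choose_spec]

theorem foxHWellDefined_of_mellinInv_eq {p q m n : ℕ} {a : Fin p → ℂ × ℝ} {b : Fin q → ℂ × ℝ}
    {z : ℝ} (hz : 0 < z) {v : ℂ} (hex : ∃ σ, FoxHSeparates m n a b σ)
    (hint : ∀ σ, FoxHSeparates m n a b σ → VerticalIntegrable (foxHKernel m n a b) σ)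
    (hv : ∀ σ, FoxHSeparates m n a b σ → mellinInv σ (foxHKernel m n a b) z = v) :
    FoxHWellDefined m n a b z :=
  ⟨hex, fun σ hσ => ⟨integrable_cpow_mul (hint σ hσ) hz, by
    rw [foxH_eq_of_mellinInv_eq hex hv, foxHLine_eq_mellinInv, hv σ hσ]⟩⟩

variable {σ B z : ℝ} {ν a : ℂ}

theorem foxHSeparates_two_one_iff (ha : 0 ≤ a.re) (hB : 0 < B) :
    FoxHSeparates 2 1 ![(1 - ν, 1)] ![(0, 1), (a, B)] σ ↔ 0 < σ ∧ σ < ν.re := by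
  have hpole (k : ℕ) : -(a.re + k) / B ≤ 0 :=
    div_nonpos_of_nonpos_of_nonneg (by linarith [k.cast_nonneg (α := ℝ)]) hB.le
  simp only [FoxHSeparates, Fin.forall_fin_two, Fin.forall_fin_one, div_ofReal_re]
  constructor
  · rintro ⟨⟨h₀, -⟩, h₁⟩
    exact ⟨by simpa using h₀ (by simp) 0, by simpa using h₁ (by simp) 0⟩
  · rintro ⟨h₀, h₁⟩
    refine ⟨⟨fun _ k => ?_, fun _ k => ?_⟩, fun _ k => ?_⟩
    · simpa using by linarith [k.cast_nonneg (α := ℝ)]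
    · simpa using (hpole k).trans_lt h₀
    · simpa using by linarith [k.cast_nonneg (α := ℝ)]

theorem foxHKernel_two_one :
    foxHKernel 2 1 ![(1 - ν, 1)] ![(0, 1), (a, B)] =
      fun s => Gamma s * Gamma (ν - s) * Gamma (a + B * s) := by
  ext s
  simp [foxHKernel, Fin.prod_univ_two, mul_right_comm]

theorem verticalIntegrable_foxHKernel_two_one (ha : 0 ≤ a.re) (hB : 0 < B) (hσ : 0 < σ)
    (hν : σ < ν.re) : VerticalIntegrable (foxHKernel 2 1 ![(1 - ν, 1)] ![(0, 1), (a, B)]) σ := by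
  rw [foxHKernel_two_one]
  exact verticalIntegrable_mul_Gamma (verticalIntegrable_Gamma_mul_Gamma_sub hσ hν) (by positivity)

theorem mellinInv_foxHKernel_two_one (ha : 0 ≤ a.re) (hB : 0 < B) (hσ : 0 < σ)
    (hν : σ < ν.re) (hz : 0 < z) :
    mellinInv σ (foxHKernel 2 1 ![(1 - ν, 1)] ![(0, 1), (a, B)]) z =
      Gamma ν * ∫ x in Ioi (0 : ℝ),
        (x : ℂ) ^ (a - 1) * Real.exp (-x) * ((1 + z * x ^ (-B) : ℝ) : ℂ) ^ (-ν) := by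
  rw [foxHKernel_two_one, mellinInv_mul_Gamma (verticalIntegrable_Gamma_mul_Gamma_sub hσ hν)
    (by positivity) hz, ← integral_const_mul]
  refine setIntegral_congr_fun measurableSet_Ioi fun x (hx : 0 < x) => ?_
  rw [mellinInv_Gamma_mul_Gamma_sub hσ hν (by positivity), mul_left_comm]

theorem exists_foxHSeparates_two_one (ha : 0 ≤ a.re) (hB : 0 < B) (hν : 0 < ν.re) :
    ∃ σ, FoxHSeparates 2 1 ![(1 - ν, 1)] ![(0, 1), (a, B)] σ :=
  ⟨ν.re / 2, (foxHSeparates_two_one_iff ha hB).2 ⟨half_pos hν, half_lt_self hν⟩⟩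

theorem foxHWellDefined_two_one (ha : 0 ≤ a.re) (hB : 0 < B) (hν : 0 < ν.re) (hz : 0 < z) :
    FoxHWellDefined 2 1 ![(1 - ν, 1)] ![(0, 1), (a, B)] z := by
  have hsep {σ : ℝ} := foxHSeparates_two_one_iff (σ := σ) (ν := ν) ha hB
  refine foxHWellDefined_of_mellinInv_eq hz (exists_foxHSeparates_two_one ha hB hν)
    (fun σ hσ => verticalIntegrable_foxHKernel_two_one ha hB ?_ ?_)
    (fun σ hσ => mellinInv_foxHKernel_two_one ha hB ?_ ?_ hz)
  exacts [(hsep.1 hσ).1, (hsep.1 hσ).2, (hsep.1 hσ).1, (hsep.1 hσ).2]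

theorem foxH_two_one (ha : 0 ≤ a.re) (hB : 0 < B) (hν : 0 < ν.re) (hz : 0 < z) :
    foxH 2 1 ![(1 - ν, 1)] ![(0, 1), (a, B)] z =
      Gamma ν * ∫ x in Ioi (0 : ℝ),
        (x : ℂ) ^ (a - 1) * Real.exp (-x) * ((1 + z * x ^ (-B) : ℝ) : ℂ) ^ (-ν) := by
  refine foxH_eq_of_mellinInv_eq (exists_foxHSeparates_two_one ha hB hν) fun σ hσ => ?_
  obtain ⟨hσ, hσν⟩ := (foxHSeparates_two_one_iff ha hB).1 hσ
  exact mellinInv_foxHKernel_two_one ha hB hσ hσν hz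

end FoxH

section GammaDistribution

open Real Set Filter

theorem gammaMeasure_eq_withDensity_restrict (a r : ℝ) :
    gammaMeasure a r = (volume.restrict (Ioi 0)).withDensity (gammaPDF a r) := by
  rw [gammaMeasure, ← withDensity_indicator measurableSet_Ioi]
  refine withDensity_congr_ae ?_
  filter_upwards [compl_mem_ae_iff.2 (measure_singleton (0 : ℝ))] with x hx
  rcases lt_or_gt_of_ne hx with hx | hx
  · rw [gammaPDF_of_neg hx, indicator_of_notMem (notMem_Ioi.2 hx.le)]
  · rw [indicator_of_mem (mem_Ioi.2 hx)]

theorem toReal_gammaPDF {a r x : ℝ} (ha : 0 < a) (hr : 0 < r) (hx : 0 ≤ x) :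
    (gammaPDF a r x).toReal = r ^ a / Gamma a * x ^ (a - 1) * exp (-(r * x)) := by
  rw [gammaPDF, ENNReal.toReal_ofReal (gammaPDFReal_nonneg ha hr x), gammaPDFReal, if_pos hx]

theorem integrable_gammaMeasure_iff {E : Type*} [NormedAddCommGroup E] [NormedSpace ℝ E]
    {a r : ℝ} (ha : 0 < a) (hr : 0 < r) {f : ℝ → E} :
    Integrable f (gammaMeasure a r) ↔
      IntegrableOn (fun x => (r ^ a / Gamma a * x ^ (a - 1) * exp (-(r * x))) • f x) (Ioi 0) := by
  rw [gammaMeasure_eq_withDensity_restrict, integrable_withDensity_iff_integrable_smul'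
    (f := gammaPDF a r) (measurable_gammaPDFReal a r).ennreal_ofReal
    (.of_forall fun _ => ENNReal.ofReal_lt_top)]
  refine integrableOn_congr_fun (fun x (hx : 0 < x) => ?_) measurableSet_Ioi
  rw [toReal_gammaPDF ha hr hx.le]

theorem integral_gammaMeasure {E : Type*} [NormedAddCommGroup E] [NormedSpace ℝ E]
    {a r : ℝ} (ha : 0 < a) (hr : 0 < r) (f : ℝ → E) :
    ∫ x, f x ∂gammaMeasure a r =
      ∫ x in Ioi 0, (r ^ a / Gamma a * x ^ (a - 1) * exp (-(r * x))) • f x := by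
  rw [gammaMeasure_eq_withDensity_restrict, integral_withDensity_eq_integral_toReal_smul
    (f := gammaPDF a r) (measurable_gammaPDFReal a r).ennreal_ofReal
    (.of_forall fun _ => ENNReal.ofReal_lt_top)]
  refine setIntegral_congr_fun measurableSet_Ioi fun x (hx : 0 < x) => ?_
  rw [toReal_gammaPDF ha hr hx.le]

theorem gammaDensity_smul_rpow {a r s x : ℝ} (hx : 0 < x) :
    (r ^ a / Gamma a * x ^ (a - 1) * exp (-(r * x))) • x ^ s =
      r ^ a / Gamma a * (x ^ (a + s - 1) * exp (-(r * x))) := by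
  rw [smul_eq_mul, add_sub_right_comm, rpow_add hx]
  ring

theorem integrable_rpow_gammaMeasure {a r s : ℝ} (ha : 0 < a) (hr : 0 < r) (hs : 0 < a + s) :
    Integrable (fun x => x ^ s) (gammaMeasure a r) := by
  have h : IntegrableOn (fun x => x ^ (a + s - 1) * exp (-(r * x))) (Ioi 0) := by
    simpa only [rpow_one, neg_mul] using
      integrableOn_rpow_mul_exp_neg_mul_rpow (s := a + s - 1) (by linarith) one_pos hr
  rw [integrable_gammaMeasure_iff ha hr]
  exact IntegrableOn.congr_fun (Integrable.const_mul h _)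
    (fun x hx => (gammaDensity_smul_rpow hx).symm) measurableSet_Ioi

theorem integral_rpow_gammaMeasure {a r s : ℝ} (ha : 0 < a) (hr : 0 < r) (hs : 0 < a + s) :
    ∫ x, x ^ s ∂gammaMeasure a r = Gamma (a + s) / (r ^ s * Gamma a) := by
  rw [integral_gammaMeasure ha hr, setIntegral_congr_fun measurableSet_Ioi
    fun x hx => gammaDensity_smul_rpow hx, integral_const_mul,
    integral_rpow_mul_exp_neg_mul_Ioi hs hr, one_div, inv_rpow hr.le, rpow_add hr]
  field_simp

end GammaDistribution

section GeneralizedGamma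

open Real Set Filter

theorem map_withDensity_abs_deriv {s : Set ℝ} {φ φ' : ℝ → ℝ} (hs : MeasurableSet s)
    (hφ' : ∀ x ∈ s, HasDerivWithinAt φ (φ' x) s x) (hinj : InjOn φ s) (hφ : Measurable φ)
    (g : ℝ → ENNReal) :
    ((volume.restrict s).withDensity fun x => ENNReal.ofReal |φ' x| * g (φ x)).map φ =
      (volume.restrict (φ '' s)).withDensity g := by
  ext t ht
  have hst : MeasurableSet (s ∩ φ ⁻¹' t) := hs.inter (hφ ht)
  rw [Measure.map_apply hφ ht, withDensity_apply _ (hφ ht), withDensity_apply _ ht,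
    Measure.restrict_restrict (hφ ht), Measure.restrict_restrict ht, inter_comm, inter_comm t,
    ← image_inter_preimage, lintegral_image_eq_lintegral_abs_deriv_mul hst
      (fun x hx => (hφ' x hx.1).mono inter_subset_left) (hinj.mono inter_subset_left)]

/-- The density on `(0, ∞)` of the generalized Gamma distribution with shape parameters `a`, `c`
and scale `b`. -/
noncomputable def genGammaPDF (a b c x : ℝ) : ℝ :=
  c * x ^ (a * c - 1) / (b ^ (a * c) * Gamma a) * exp (-((x / b) ^ c))

/-- The generalized Gamma distribution: the law of `b * G ^ (1 / c)`, where `G` has the standard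
Gamma distribution of shape `a`. It is the exponential distribution of mean `b` for
`a = c = 1`. -/
noncomputable def genGammaMeasure (a b c : ℝ) : Measure ℝ :=
  (volume.restrict (Ioi 0)).withDensity fun x => ENNReal.ofReal (genGammaPDF a b c x)

variable {a b c : ℝ}

theorem measurable_genGammaPDF : Measurable (genGammaPDF a b c) := by
  unfold genGammaPDF
  fun_prop

theorem genGammaPDF_nonneg (ha : 0 < a) (hb : 0 < b) (hc : 0 < c) {x : ℝ} (hx : 0 < x) :
    0 ≤ genGammaPDF a b c x := by
  have := Gamma_pos_of_pos ha
  unfold genGammaPDF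
  positivity

theorem genGammaPDF_eq_mul_gammaPDFReal (hb : 0 < b) {x : ℝ} (hx : 0 < x) :
    genGammaPDF a b c x = c * (x / b) ^ (c - 1) / b * gammaPDFReal a 1 ((x / b) ^ c) := by
  have hxb : 0 < x / b := by positivity
  have hpow : (x / b) ^ (c - 1) * ((x / b) ^ c) ^ (a - 1) = x ^ (a * c - 1) / b ^ (a * c) * b := by
    rw [← rpow_mul hxb.le, ← rpow_add hxb, show c - 1 + c * (a - 1) = a * c - 1 by ring,
      div_rpow hx.le hb.le, rpow_sub_one hb.ne']
    field_simp
  rw [gammaPDFReal, if_pos (by positivity), one_rpow, one_mul]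
  calc genGammaPDF a b c x
      = c / b * (x ^ (a * c - 1) / b ^ (a * c) * b) / Gamma a * exp (-(x / b) ^ c) := by
        rw [genGammaPDF]
        field_simp
    _ = _ := by
        rw [← hpow]
        ring

theorem image_div_rpow_Ioi (hb : 0 < b) (hc : c ≠ 0) :
    (fun x => (x / b) ^ c) '' Ioi 0 = Ioi 0 := by
  ext y
  constructor
  · rintro ⟨x, hx : 0 < x, rfl⟩
    exact rpow_pos_of_pos (div_pos hx hb) c
  · intro (hy : 0 < y)
    refine ⟨b * y ^ c⁻¹, by simp only [mem_Ioi]; positivity, ?_⟩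
    beta_reduce
    rw [mul_div_cancel_left₀ _ hb.ne', rpow_inv_rpow hy.le hc]

theorem measurePreserving_genGammaMeasure (hb : 0 < b) (hc : 0 < c) :
    MeasurePreserving (fun x => (x / b) ^ c) (genGammaMeasure a b c) (gammaMeasure a 1) := by
  refine ⟨by fun_prop, ?_⟩
  have hderiv : ∀ x ∈ Ioi (0 : ℝ),
      HasDerivWithinAt (fun x => (x / b) ^ c) (c * (x / b) ^ (c - 1) / b) (Ioi 0) x := by
    intro x (hx : 0 < x)
    have := ((hasDerivAt_id x).div_const b).rpow_const (p := c) (.inl (div_pos hx hb).ne')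
    refine (this.congr_deriv ?_).hasDerivWithinAt
    simp only [id]
    ring
  have hinj : InjOn (fun x => (x / b) ^ c) (Ioi 0) := fun x hx y hy h =>
    (div_left_inj' hb.ne').1 (rpow_left_injOn hc.ne' (div_pos hx hb).le (div_pos hy hb).le h)
  rw [gammaMeasure_eq_withDensity_restrict, ← image_div_rpow_Ioi hb hc.ne',
    ← map_withDensity_abs_deriv measurableSet_Ioi hderiv hinj (by fun_prop), genGammaMeasure]
  congr 1
  refine withDensity_congr_ae ?_
  filter_upwards [ae_restrict_mem measurableSet_Ioi] with x (hx : 0 < x)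
  rw [gammaPDF, ← ENNReal.ofReal_mul (abs_nonneg _), genGammaPDF_eq_mul_gammaPDFReal hb hx,
    abs_of_pos (by positivity)]

theorem isProbabilityMeasure_genGammaMeasure (ha : 0 < a) (hb : 0 < b) (hc : 0 < c) :
    IsProbabilityMeasure (genGammaMeasure a b c) :=
  have := isProbabilityMeasure_gammaMeasure ha one_pos
  (measurePreserving_genGammaMeasure hb hc).hasLaw.isProbabilityMeasure

theorem ae_genGammaMeasure_pos : ∀ᵐ x ∂genGammaMeasure a b c, 0 < x :=
  (withDensity_absolutelyContinuous _ _).ae_le (ae_restrict_mem measurableSet_Ioi)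

theorem rpow_ae_eq_genGammaMeasure (hb : 0 < b) (hc : c ≠ 0) (s : ℝ) :
    (fun x => x ^ s) =ᵐ[genGammaMeasure a b c] fun x => b ^ s * ((x / b) ^ c) ^ (s / c) := by
  filter_upwards [ae_genGammaMeasure_pos] with x hx
  rw [← rpow_mul (by positivity), mul_div_cancel₀ _ hc, ← mul_rpow hb.le (by positivity),
    mul_div_cancel₀ _ hb.ne']

theorem integrable_rpow_genGammaMeasure (ha : 0 < a) (hb : 0 < b) (hc : 0 < c) {s : ℝ}
    (hs : 0 < a + s / c) : Integrable (fun x => x ^ s) (genGammaMeasure a b c) := by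
  refine Integrable.congr ?_ (rpow_ae_eq_genGammaMeasure hb hc.ne' s).symm
  exact ((measurePreserving_genGammaMeasure hb hc).integrable_comp_of_integrable
    (integrable_rpow_gammaMeasure ha one_pos hs)).const_mul _

theorem integral_comp_genGammaMeasure {E : Type*} [NormedAddCommGroup E] [NormedSpace ℝ E]
    (hb : 0 < b) (hc : 0 < c) {f : ℝ → E} (hf : AEStronglyMeasurable f (gammaMeasure a 1)) :
    ∫ x, f ((x / b) ^ c) ∂genGammaMeasure a b c = ∫ y, f y ∂gammaMeasure a 1 :=
  (measurePreserving_genGammaMeasure hb hc).hasLaw.integral_comp hf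

theorem integral_rpow_genGammaMeasure (ha : 0 < a) (hb : 0 < b) (hc : 0 < c) {s : ℝ}
    (hs : 0 < a + s / c) :
    ∫ x, x ^ s ∂genGammaMeasure a b c = b ^ s * Gamma (a + s / c) / Gamma a := by
  rw [integral_congr_ae (rpow_ae_eq_genGammaMeasure hb hc.ne' s), integral_const_mul,
    integral_comp_genGammaMeasure hb hc (f := fun y => y ^ (s / c)) (by fun_prop),
    integral_rpow_gammaMeasure ha one_pos hs, one_rpow, one_mul, mul_div_assoc]

end GeneralizedGamma

section EGG

open Real Set

theorem eggPDF_eq_indicator (p : EGGParams) :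
    eggPDF p = (Ioi 0).indicator fun x =>
      p.w * genGammaPDF 1 p.lam 1 x + (1 - p.w) * genGammaPDF p.a p.b p.c x := by
  ext x
  rw [indicator_apply, eggPDF]
  refine if_congr Iff.rfl ?_ rfl
  simp only [genGammaPDF, Gamma_one, rpow_one, mul_one, sub_self, rpow_zero]
  ring

theorem eggMeasure_eq_withDensity_restrict (p : EGGParams) :
    eggMeasure p = (volume.restrict (Ioi 0)).withDensity fun x =>
      ENNReal.ofReal (p.w * genGammaPDF 1 p.lam 1 x + (1 - p.w) * genGammaPDF p.a p.b p.c x) := by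
  rw [eggMeasure, eggPDF_eq_indicator, ← withDensity_indicator measurableSet_Ioi]
  exact congrArg _ (indicator_comp_of_zero ENNReal.ofReal_zero).symm

theorem eggMeasure_eq_mixture (p : EGGParams) :
    eggMeasure p = ENNReal.ofReal p.w • genGammaMeasure 1 p.lam 1 +
      ENNReal.ofReal (1 - p.w) • genGammaMeasure p.a p.b p.c := by
  have hw : 0 ≤ 1 - p.w := sub_nonneg.2 p.w_lt_one.le
  have hmeas₁ := (measurable_genGammaPDF (a := 1) (b := p.lam) (c := 1)).ennreal_ofReal
  have hmeas₂ := (measurable_genGammaPDF (a := p.a) (b := p.b) (c := p.c)).ennreal_ofReal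
  rw [eggMeasure_eq_withDensity_restrict, genGammaMeasure, genGammaMeasure,
    ← withDensity_smul _ hmeas₁, ← withDensity_smul _ hmeas₂,
    ← withDensity_add_left (hmeas₁.const_smul _)]
  refine withDensity_congr_ae ?_
  filter_upwards [ae_restrict_mem measurableSet_Ioi] with x (hx : 0 < x)
  have h₁ := genGammaPDF_nonneg one_pos p.lam_pos one_pos hx
  have h₂ := genGammaPDF_nonneg p.a_pos p.b_pos p.c_pos hx
  rw [ENNReal.ofReal_add (mul_nonneg p.w_pos.le h₁) (mul_nonneg hw h₂),
    ENNReal.ofReal_mul p.w_pos.le, ENNReal.ofReal_mul hw]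
  rfl

theorem eggMeasure_absolutelyContinuous (p : EGGParams) :
    eggMeasure p ≪ volume.restrict (Ioi 0) := by
  rw [eggMeasure_eq_withDensity_restrict]
  exact withDensity_absolutelyContinuous _ _

theorem ae_eggMeasure_pos (p : EGGParams) : ∀ᵐ x ∂eggMeasure p, 0 < x :=
  (eggMeasure_absolutelyContinuous p).ae_le (ae_restrict_mem measurableSet_Ioi)

variable {E : Type*} [NormedAddCommGroup E] {p : EGGParams} {f : ℝ → E}

theorem integrable_eggMeasure (h₁ : Integrable f (genGammaMeasure 1 p.lam 1))
    (h₂ : Integrable f (genGammaMeasure p.a p.b p.c)) : Integrable f (eggMeasure p) := by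
  rw [eggMeasure_eq_mixture]
  exact (h₁.smul_measure ENNReal.ofReal_ne_top).add_measure
    (h₂.smul_measure ENNReal.ofReal_ne_top)

theorem integral_eggMeasure [NormedSpace ℝ E] (h₁ : Integrable f (genGammaMeasure 1 p.lam 1))
    (h₂ : Integrable f (genGammaMeasure p.a p.b p.c)) :
    ∫ x, f x ∂eggMeasure p = p.w • ∫ x, f x ∂genGammaMeasure 1 p.lam 1 +
      (1 - p.w) • ∫ x, f x ∂genGammaMeasure p.a p.b p.c := by
  rw [eggMeasure_eq_mixture, integral_add_measure (h₁.smul_measure ENNReal.ofReal_ne_top)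
    (h₂.smul_measure ENNReal.ofReal_ne_top), integral_smul_measure, integral_smul_measure,
    ENNReal.toReal_ofReal p.w_pos.le, ENNReal.toReal_ofReal (sub_nonneg.2 p.w_lt_one.le)]

theorem integrable_rpow_eggMeasure {s : ℝ} (h₁ : 0 < 1 + s) (h₂ : 0 < p.a + s / p.c) :
    Integrable (fun x => x ^ s) (eggMeasure p) :=
  integrable_eggMeasure (integrable_rpow_genGammaMeasure one_pos p.lam_pos one_pos (by simpa))
    (integrable_rpow_genGammaMeasure p.a_pos p.b_pos p.c_pos h₂)

theorem integral_rpow_eggMeasure {s : ℝ} (h₁ : 0 < 1 + s) (h₂ : 0 < p.a + s / p.c) :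
    ∫ x, x ^ s ∂eggMeasure p = p.w * (p.lam ^ s * Gamma (1 + s)) +
      (1 - p.w) * (p.b ^ s * Gamma (p.a + s / p.c) / Gamma p.a) := by
  have h₁' : 0 < 1 + s / 1 := by simpa
  rw [integral_eggMeasure (integrable_rpow_genGammaMeasure one_pos p.lam_pos one_pos h₁')
    (integrable_rpow_genGammaMeasure p.a_pos p.b_pos p.c_pos h₂),
    integral_rpow_genGammaMeasure one_pos p.lam_pos one_pos h₁',
    integral_rpow_genGammaMeasure p.a_pos p.b_pos p.c_pos h₂, div_one, Gamma_one, div_one,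
    smul_eq_mul, smul_eq_mul]

end EGG

section Relay

open Real Set

/-- The factor `g / (g + C)` by which the second hop, with SNR `g`, reduces the SNR of the first
one in a fixed gain relay with relay constant `C`. -/
noncomputable def relayGain (C g : ℝ) : ℝ := g / (g + C)

theorem endToEndSNR_eq_mul_relayGain (C g₁ g₂ : ℝ) :
    endToEndSNR C g₁ g₂ = g₁ * relayGain C g₂ :=
  mul_div_assoc g₁ g₂ (g₂ + C)

variable {C g ν : ℝ}

theorem measurable_relayGain : Measurable (relayGain C) := by
  unfold relayGain
  fun_prop

theorem relayGain_pos (hC : 0 ≤ C) (hg : 0 < g) : 0 < relayGain C g :=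
  div_pos hg (by positivity)

theorem relayGain_mem_Icc (hC : 0 ≤ C) (hg : 0 ≤ g) : relayGain C g ∈ Icc 0 1 :=
  ⟨div_nonneg hg (by positivity), div_le_one_of_le₀ (by linarith) (by positivity)⟩

theorem relayGain_rpow (hC : 0 ≤ C) (hg : 0 < g) :
    relayGain C g ^ ν = (1 + C / g) ^ (-ν) := by
  rw [rpow_neg (by positivity), ← inv_rpow (by positivity), relayGain]
  congr 1
  field_simp

theorem integrable_relayGain_rpow {Ω : Type*} [MeasurableSpace Ω] {P : Measure Ω}
    [IsFiniteMeasure P] {X : Ω → ℝ} (hX : AEMeasurable X P) (hpos : ∀ᵐ ω ∂P, 0 ≤ X ω)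
    (hC : 0 ≤ C) (hν : 0 ≤ ν) : Integrable (fun ω => relayGain C (X ω) ^ ν) P := by
  refine Integrable.of_bound (C := 1)
    ((measurable_relayGain.comp_aemeasurable hX).pow_const ν).aestronglyMeasurable ?_
  filter_upwards [hpos] with ω hω
  obtain ⟨h₀, h₁⟩ := relayGain_mem_Icc hC hω
  rw [norm_of_nonneg (rpow_nonneg h₀ ν)]
  exact rpow_le_one h₀ h₁ hν

theorem relayGain_rpow_ae_eq_genGammaMeasure {a b c μ r : ℝ} (hb : 0 < b) (hc : c ≠ 0)
    (hμ : 0 < μ) (hC : 0 ≤ C) :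
    (fun x => relayGain C (μ * x ^ r) ^ ν) =ᵐ[genGammaMeasure a b c]
      fun x => (1 + C / (b ^ r * μ) * ((x / b) ^ c) ^ (-(r / c))) ^ (-ν) := by
  filter_upwards [ae_genGammaMeasure_pos] with x hx
  have hpow : ((x / b) ^ c) ^ (-(r / c)) = b ^ r / x ^ r := by
    rw [← rpow_mul (by positivity), mul_neg, mul_div_cancel₀ _ hc, rpow_neg (by positivity),
      div_rpow hx.le hb.le, inv_div]
  rw [relayGain_rpow hC (by positivity), hpow]
  congr 2
  field_simp

theorem integral_relayGain_rpow_genGammaMeasure {a b c μ r : ℝ} (ha : 0 < a) (hb : 0 < b)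
    (hc : 0 < c) (hμ : 0 < μ) (hC : 0 ≤ C) :
    ∫ x, relayGain C (μ * x ^ r) ^ ν ∂genGammaMeasure a b c =
      (∫ x in Ioi 0, x ^ (a - 1) * exp (-x) *
        (1 + C / (b ^ r * μ) * x ^ (-(r / c))) ^ (-ν)) / Gamma a := by
  rw [integral_congr_ae (relayGain_rpow_ae_eq_genGammaMeasure hb hc.ne' hμ hC),
    integral_comp_genGammaMeasure hb hc
      (f := fun y => (1 + C / (b ^ r * μ) * y ^ (-(r / c))) ^ (-ν))
      (Measurable.aestronglyMeasurable (by fun_prop)),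
    integral_gammaMeasure ha one_pos, ← integral_div]
  refine integral_congr_ae (.of_forall fun x => ?_)
  simp only [one_rpow, one_mul, smul_eq_mul]
  ring

theorem ofReal_integral_relayGain_rpow_genGammaMeasure {a b c μ r : ℝ} (ha : 0 < a) (hb : 0 < b)
    (hc : 0 < c) (hμ : 0 < μ) (hr : 0 < r) (hC : 0 < C) (hν : 0 < ν) :
    ((∫ x, relayGain C (μ * x ^ r) ^ ν ∂genGammaMeasure a b c : ℝ) : ℂ) =
      foxH 2 1 ![((1 - ν : ℂ), (1 : ℝ))] ![((0 : ℂ), (1 : ℝ)), ((a : ℂ), (r / c : ℝ))]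
        ((C / (b ^ r * μ) : ℝ) : ℂ) / ((Gamma ν * Gamma a : ℝ) : ℂ) := by
  rw [integral_relayGain_rpow_genGammaMeasure ha hb hc hμ hC.le]
  have hz : 0 < C / (b ^ r * μ) := by positivity
  generalize C / (b ^ r * μ) = z at hz ⊢
  have hcast : ((∫ x in Ioi 0,
      x ^ (a - 1) * exp (-x) * (1 + z * x ^ (-(r / c))) ^ (-ν) : ℝ) : ℂ) =
      ∫ x in Ioi (0 : ℝ), (x : ℂ) ^ ((a : ℂ) - 1) * exp (-x) *
        ((1 + z * x ^ (-(r / c)) : ℝ) : ℂ) ^ (-(ν : ℂ)) := by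
    refine integral_complex_ofReal.symm.trans
      (setIntegral_congr_fun measurableSet_Ioi fun x (hx : 0 < x) => ?_)
    have hbase : 0 ≤ 1 + z * x ^ (-(r / c)) := by positivity
    simp only [Complex.ofReal_mul, Complex.ofReal_cpow hx.le, Complex.ofReal_cpow hbase,
      Complex.ofReal_sub, Complex.ofReal_one, Complex.ofReal_neg]
  have hΓν : (Gamma ν : ℂ) ≠ 0 := Complex.ofReal_ne_zero.2 (Gamma_pos_of_pos hν).ne'
  rw [foxH_two_one (by simpa using ha.le) (by positivity) (by simpa) hz, ← hcast,
    Complex.Gamma_ofReal]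
  push_cast
  field_simp

end Relay

section Hop

open Real Set

variable {η N : ℝ} {r : ℕ} {p : EGGParams} {ν C : ℝ}

theorem hopSNR_eq_electricalSNR_mul (η N : ℝ) (r : ℕ) (x : ℝ) :
    hopSNR η N r x = electricalSNR η N r * x ^ r := by
  rw [hopSNR, electricalSNR, mul_pow, div_mul_eq_mul_div]

theorem electricalSNR_pos (hη : 0 < η) (hN : 0 < N) : 0 < electricalSNR η N r := by
  unfold electricalSNR
  positivity

theorem hopSNR_pos (hη : 0 < η) (hN : 0 < N) {x : ℝ} (hx : 0 < x) : 0 < hopSNR η N r x := by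
  unfold hopSNR
  positivity

theorem hopSNR_rpow_ae_eq (hη : 0 < η) (hN : 0 < N) :
    (fun x => hopSNR η N r x ^ ν) =ᵐ[eggMeasure p]
      fun x => electricalSNR η N r ^ ν * x ^ (r * ν) := by
  have hμ := electricalSNR_pos (r := r) hη hN
  filter_upwards [ae_eggMeasure_pos p] with x hx
  rw [hopSNR_eq_electricalSNR_mul, mul_rpow hμ.le (by positivity), rpow_mul hx.le, rpow_natCast]

theorem integrable_hopSNR_rpow (hη : 0 < η) (hN : 0 < N) (h₁ : 0 < 1 + r * ν)
    (h₂ : 0 < p.a + r * ν / p.c) : Integrable (fun x => hopSNR η N r x ^ ν) (eggMeasure p) :=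
  ((integrable_rpow_eggMeasure h₁ h₂).const_mul _).congr (hopSNR_rpow_ae_eq hη hN).symm

theorem integral_hopSNR_rpow (hη : 0 < η) (hN : 0 < N) (h₁ : 0 < 1 + r * ν)
    (h₂ : 0 < p.a + r * ν / p.c) :
    ∫ x, hopSNR η N r x ^ ν ∂eggMeasure p =
      p.w * Gamma (1 + r * ν) * (p.lam ^ r * electricalSNR η N r) ^ ν +
      (1 - p.w) * (p.b ^ r * electricalSNR η N r) ^ ν * Gamma (p.a + r * ν / p.c) / Gamma p.a := by
  have hμ := electricalSNR_pos (r := r) hη hN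
  have hpow {t : ℝ} (ht : 0 < t) : (t ^ r * electricalSNR η N r) ^ ν =
      electricalSNR η N r ^ ν * t ^ (r * ν) := by
    rw [mul_rpow (by positivity) hμ.le, rpow_mul ht.le, rpow_natCast, mul_comm]
  rw [integral_congr_ae (hopSNR_rpow_ae_eq hη hN), integral_const_mul,
    integral_rpow_eggMeasure h₁ h₂, hpow p.lam_pos, hpow p.b_pos]
  ring

theorem integrable_relayGain_hopSNR_genGammaMeasure {a b c : ℝ} (ha : 0 < a) (hb : 0 < b)
    (hc : 0 < c) (hη : 0 < η) (hN : 0 < N) (hC : 0 ≤ C) (hν : 0 ≤ ν) :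
    Integrable (fun x => relayGain C (hopSNR η N r x) ^ ν) (genGammaMeasure a b c) := by
  have := isProbabilityMeasure_genGammaMeasure ha hb hc
  refine integrable_relayGain_rpow (by unfold hopSNR; fun_prop) ?_ hC hν
  filter_upwards [ae_genGammaMeasure_pos] with x hx using (hopSNR_pos hη hN hx).le

theorem ofReal_integral_relayGain_hopSNR_rpow (hη : 0 < η) (hN : 0 < N) (hr : r ≠ 0) (hC : 0 < C)
    (hν : 0 < ν) :
    ((∫ x, relayGain C (hopSNR η N r x) ^ ν ∂eggMeasure p : ℝ) : ℂ) =
      ((p.w / Gamma ν : ℝ) : ℂ) *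
        foxH 2 1 ![((1 - ν : ℂ), (1 : ℝ))] ![((0 : ℂ), (1 : ℝ)), ((1 : ℂ), (r : ℝ))]
          ((C / (p.lam ^ r * electricalSNR η N r) : ℝ) : ℂ) +
      (((1 - p.w) / (Gamma ν * Gamma p.a) : ℝ) : ℂ) *
        foxH 2 1 ![((1 - ν : ℂ), (1 : ℝ))] ![((0 : ℂ), (1 : ℝ)), ((p.a : ℂ), (r / p.c : ℝ))]
          ((C / (p.b ^ r * electricalSNR η N r) : ℝ) : ℂ) := by
  have hr₀ : (0 : ℝ) < r := Nat.cast_pos.2 (Nat.pos_of_ne_zero hr)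
  have hμ := electricalSNR_pos (r := r) hη hN
  have hcomp {a b c : ℝ} (ha : 0 < a) (hb : 0 < b) (hc : 0 < c) :=
    ofReal_integral_relayGain_rpow_genGammaMeasure ha hb hc hμ hr₀ hC hν
  simp only [rpow_natCast, ← hopSNR_eq_electricalSNR_mul] at hcomp
  rw [integral_eggMeasure
    (integrable_relayGain_hopSNR_genGammaMeasure one_pos p.lam_pos one_pos hη hN hC.le hν.le)
    (integrable_relayGain_hopSNR_genGammaMeasure p.a_pos p.b_pos p.c_pos hη hN hC.le hν.le)]
  push_cast [smul_eq_mul, hcomp one_pos p.lam_pos one_pos, hcomp p.a_pos p.b_pos p.c_pos]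
  simp only [div_one, Gamma_one, Complex.ofReal_one]
  ring

end Hop

section Density

open Set

theorem quasiMeasurePreserving_of_deriv_ne_zero {s : Set ℝ} {φ : ℝ → ℝ} (hs : MeasurableSet s)
    (hd : ∀ x ∈ s, deriv φ x ≠ 0) (hinj : InjOn φ s) (hφ : Measurable φ) :
    Measure.QuasiMeasurePreserving φ (volume.restrict s) volume := by
  refine ⟨hφ, ?_⟩
  have hmap := map_withDensity_abs_deriv hs
    (fun x hx => (differentiableAt_of_deriv_ne_zero (hd x hx)).hasDerivAt.hasDerivWithinAt)
    hinj hφ 1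
  have hac : volume.restrict s ≪
      (volume.restrict s).withDensity fun x => ENNReal.ofReal |deriv φ x| * 1 := by
    refine withDensity_absolutelyContinuous' (by fun_prop) ?_
    filter_upwards [ae_restrict_mem hs] with x hx
    simpa using hd x hx
  refine (hac.map hφ).trans ?_
  simp only [Pi.one_apply] at hmap
  rw [hmap]
  exact (withDensity_absolutelyContinuous _ _).trans Measure.absolutelyContinuous_restrict

variable {Ω : Type*} [MeasurableSpace Ω] {P : Measure Ω} [IsFiniteMeasure P]

theorem hasPDF_mul_of_indepFun {X Y : Ω → ℝ} [HasPDF X P volume] (hY : AEMeasurable Y P)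
    (hind : IndepFun X Y P) (hY₀ : ∀ᵐ ω ∂P, Y ω ≠ 0) :
    HasPDF (fun ω => X ω * Y ω) P volume := by
  have hX : AEMeasurable X P := HasPDF.aemeasurable X P volume
  have hXY : AEMeasurable (fun ω => X ω * Y ω) P := hX.mul hY
  have hlaw : P.map (fun ω => X ω * Y ω) =
      ((P.map Y).prod (P.map X)).map fun z => z.2 * z.1 := by
    rw [← hind.symm.map_prod_eq_prod_map_map hY hX,
      AEMeasurable.map_map_of_aemeasurable (by fun_prop) (hY.prodMk hX)]
    rfl
  rw [Real.hasPDF_iff_of_aemeasurable hXY, hlaw]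
  refine Measure.AbsolutelyContinuous.mk fun N hN hN₀ => ?_
  rw [Measure.map_apply (by fun_prop) hN, Measure.measure_prod_null (hN.preimage (by fun_prop))]
  filter_upwards [(ae_map_iff hY (measurableSet_singleton 0).compl).2 hY₀] with y hy
  refine HasPDF.absolutelyContinuous (X := X) (μ := volume) ?_
  change volume ((· * y) ⁻¹' N) = 0
  rw [Real.volume_preimage_mul_right hy, hN₀, mul_zero]

theorem integral_comp_eq_setIntegral_pdf {E F : Type*} [MeasurableSpace E] {μ : Measure E}
    [NormedAddCommGroup F] [NormedSpace ℝ F] {X : Ω → E} [HasPDF X P μ] {s : Set E}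
    (hs : MeasurableSet s) (hmem : ∀ᵐ ω ∂P, X ω ∈ s) {f : E → F}
    (hf : AEStronglyMeasurable f (μ.restrict s)) :
    ∫ ω, f (X ω) ∂P = ∫ y in s, (pdf X P μ y).toReal • f y ∂μ := by
  calc ∫ ω, f (X ω) ∂P = ∫ ω, s.indicator f (X ω) ∂P := by
        refine integral_congr_ae ?_
        filter_upwards [hmem] with ω hω using (indicator_of_mem hω f).symm
    _ = ∫ y, (pdf X P μ y).toReal • s.indicator f y ∂μ :=
        (pdf.integral_pdf_smul ((aestronglyMeasurable_indicator_iff hs).2 hf)).symm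
    _ = ∫ y in s, (pdf X P μ y).toReal • f y ∂μ := by
        rw [← integral_indicator hs, indicator_smul s (fun y => (pdf X P μ y).toReal) f]

end Density

section EndToEnd

open Real Set

variable {Ω : Type*} [MeasurableSpace Ω] {P : Measure Ω} {I : Ω → ℝ} {η N C ν : ℝ} {r : ℕ}
  {p : EGGParams}

theorem measurable_hopSNR : Measurable (hopSNR η N r) := by
  unfold hopSNR
  fun_prop

theorem quasiMeasurePreserving_hopSNR (hη : 0 < η) (hN : 0 < N) (hr : r ≠ 0) :
    Measure.QuasiMeasurePreserving (hopSNR η N r) (volume.restrict (Ioi 0)) volume := by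
  have hμ := electricalSNR_pos (r := r) hη hN
  have hfun : hopSNR η N r = fun x => electricalSNR η N r * x ^ r :=
    funext (hopSNR_eq_electricalSNR_mul η N r)
  refine quasiMeasurePreserving_of_deriv_ne_zero measurableSet_Ioi (fun x (hx : 0 < x) => ?_) ?_
    measurable_hopSNR
  · have hderiv : deriv (hopSNR η N r) x = electricalSNR η N r * (r * x ^ (r - 1)) := by
      rw [hfun]
      exact ((hasDerivAt_pow r x).const_mul _).deriv
    rw [hderiv]
    positivity
  · rw [hfun]
    intro x (hx : 0 < x) y (hy : 0 < y) hxy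
    exact (pow_left_inj₀ hx.le hy.le hr).1 (mul_left_cancel₀ hμ.ne' hxy)

theorem ae_hopSNR_pos (hη : 0 < η) (hN : 0 < N) (hI : HasLaw I (eggMeasure p) P) :
    ∀ᵐ ω ∂P, 0 < hopSNR η N r (I ω) := by
  filter_upwards [(hI.ae_iff (p := fun x => 0 < x) (by fun_prop)).2 (ae_eggMeasure_pos p)]
    with ω hω using hopSNR_pos hη hN hω

theorem hasPDF_hopSNR [IsFiniteMeasure P] (hη : 0 < η) (hN : 0 < N) (hr : r ≠ 0)
    (hI : HasLaw I (eggMeasure p) P) : HasPDF (fun ω => hopSNR η N r (I ω)) P volume := by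
  have hac : P.map I ≪ volume.restrict (Ioi 0) :=
    hI.map_eq ▸ eggMeasure_absolutelyContinuous p
  have hpdf : HasPDF I P (volume.restrict (Ioi 0)) :=
    hasPDF_iff.2 ⟨hI.aemeasurable, inferInstance, hac⟩
  exact pdf.quasiMeasurePreserving_hasPDF' I (quasiMeasurePreserving_hopSNR hη hN hr)

theorem isAverageElectricalSNR_hopSNR (hη : 0 < η) (hN : 0 < N)
    (hI : HasLaw I (eggMeasure p) P) :
    IsAverageElectricalSNR p r (∫ ω, I ω ∂P) (∫ ω, hopSNR η N r (I ω) ∂P)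
      (electricalSNR η N r) := by
  refine ⟨?_, ?_⟩
  · rintro rfl hmean
    simp only [hopSNR_eq_electricalSNR_mul, pow_one, integral_const_mul, hmean, mul_one]
  · rintro rfl
    have hsnr : ∫ ω, hopSNR η N 2 (I ω) ∂P = electricalSNR η N 2 * (2 * p.w * p.lam ^ 2 +
        p.b ^ 2 * (1 - p.w) * Gamma (p.a + 2 / p.c) / Gamma p.a) := by
      have h₂ : 0 < p.a + (2 : ℕ) * 1 / p.c := by have := p.a_pos; have := p.c_pos; positivity
      have hmoment := integral_hopSNR_rpow (ν := 1) hη hN (by norm_num) h₂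
      have hΓ : Gamma (1 + 2) = 2 := by
        rw [add_comm, Gamma_add_one two_ne_zero, Gamma_two, mul_one]
      simp only [rpow_one, Nat.cast_ofNat, mul_one, hΓ] at hmoment
      rw [← Function.comp_def, hI.integral_comp measurable_hopSNR.aestronglyMeasurable, hmoment]
      ring
    have hpos : 0 < 2 * p.w * p.lam ^ 2 +
        p.b ^ 2 * (1 - p.w) * Gamma (p.a + 2 / p.c) / Gamma p.a := by
      have := p.a_pos
      have := p.b_pos
      have := p.c_pos
      have := p.w_pos
      have := p.lam_pos
      have := sub_pos.2 p.w_lt_one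
      positivity
    rw [hsnr, mul_div_cancel_right₀ _ hpos.ne']

variable {X Y : Ω → ℝ}

theorem hasPDF_endToEndSNR [IsFiniteMeasure P] [HasPDF X P volume] (hY : AEMeasurable Y P)
    (hind : IndepFun X Y P) (hY₀ : ∀ᵐ ω ∂P, 0 < Y ω) (hC : 0 ≤ C) :
    HasPDF (fun ω => endToEndSNR C (X ω) (Y ω)) P volume := by
  simp only [endToEndSNR_eq_mul_relayGain]
  refine hasPDF_mul_of_indepFun (measurable_relayGain.comp_aemeasurable hY)
    (hind.comp measurable_id measurable_relayGain) ?_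
  filter_upwards [hY₀] with ω hω using (relayGain_pos hC hω).ne'

theorem endToEndSNR_rpow_ae_eq (hX₀ : ∀ᵐ ω ∂P, 0 ≤ X ω) (hY₀ : ∀ᵐ ω ∂P, 0 ≤ Y ω) (hC : 0 ≤ C) :
    (fun ω => endToEndSNR C (X ω) (Y ω) ^ ν) =ᵐ[P]
      fun ω => X ω ^ ν * relayGain C (Y ω) ^ ν := by
  filter_upwards [hX₀, hY₀] with ω hX hY
  rw [endToEndSNR_eq_mul_relayGain, mul_rpow hX (relayGain_mem_Icc hC hY).1]

theorem indepFun_rpow_relayGain_rpow (hind : IndepFun X Y P) :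
    IndepFun (fun ω => X ω ^ ν) (fun ω => relayGain C (Y ω) ^ ν) P :=
  hind.comp (φ := fun x => x ^ ν) (ψ := fun y => relayGain C y ^ ν) (by fun_prop)
    (measurable_relayGain.pow_const ν)

theorem integrable_endToEndSNR_rpow [IsFiniteMeasure P] (hX : Integrable (fun ω => X ω ^ ν) P)
    (hY : AEMeasurable Y P) (hind : IndepFun X Y P) (hX₀ : ∀ᵐ ω ∂P, 0 ≤ X ω)
    (hY₀ : ∀ᵐ ω ∂P, 0 ≤ Y ω) (hC : 0 ≤ C) (hν : 0 ≤ ν) :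
    Integrable (fun ω => endToEndSNR C (X ω) (Y ω) ^ ν) P :=
  ((indepFun_rpow_relayGain_rpow hind).integrable_mul hX
    (integrable_relayGain_rpow hY hY₀ hC hν)).congr (endToEndSNR_rpow_ae_eq hX₀ hY₀ hC).symm

theorem integral_endToEndSNR_rpow (hX : AEMeasurable X P) (hY : AEMeasurable Y P)
    (hind : IndepFun X Y P) (hX₀ : ∀ᵐ ω ∂P, 0 ≤ X ω) (hY₀ : ∀ᵐ ω ∂P, 0 ≤ Y ω) (hC : 0 ≤ C) :
    ∫ ω, endToEndSNR C (X ω) (Y ω) ^ ν ∂P =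
      (∫ ω, X ω ^ ν ∂P) * ∫ ω, relayGain C (Y ω) ^ ν ∂P := by
  rw [integral_congr_ae (endToEndSNR_rpow_ae_eq hX₀ hY₀ hC)]
  exact (indepFun_rpow_relayGain_rpow hind).integral_fun_mul_eq_mul_integral
    (hX.pow_const ν).aestronglyMeasurable
    ((measurable_relayGain.comp_aemeasurable hY).pow_const ν).aestronglyMeasurable

end EndToEnd

section Moments

variable {Ω : Type*} [MeasurableSpace Ω] {P : Measure Ω} {I₁ I₂ : Ω → ℝ} {p₁ p₂ : EGGParams}
  {r₁ r₂ : ℕ} {η N₁ N₂ C ν : ℝ}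

theorem aemeasurable_hopSNR_comp {I : Ω → ℝ} {μ : Measure ℝ} {N : ℝ} {r : ℕ}
    (hI : HasLaw I μ P) : AEMeasurable (fun ω => hopSNR η N r (I ω)) P :=
  measurable_hopSNR.comp_aemeasurable hI.aemeasurable

theorem indepFun_hopSNR (hind : IndepFun I₁ I₂ P) :
    IndepFun (fun ω => hopSNR η N₁ r₁ (I₁ ω)) (fun ω => hopSNR η N₂ r₂ (I₂ ω)) P :=
  hind.comp measurable_hopSNR measurable_hopSNR

theorem ae_endToEndSNR_hopSNR_pos (hI₁ : HasLaw I₁ (eggMeasure p₁) P)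
    (hI₂ : HasLaw I₂ (eggMeasure p₂) P) (hη : 0 < η) (hN₁ : 0 < N₁) (hN₂ : 0 < N₂)
    (hC : 0 ≤ C) :
    ∀ᵐ ω ∂P, 0 < endToEndSNR C (hopSNR η N₁ r₁ (I₁ ω)) (hopSNR η N₂ r₂ (I₂ ω)) := by
  filter_upwards [ae_hopSNR_pos hη hN₁ hI₁, ae_hopSNR_pos hη hN₂ hI₂] with ω h₁ h₂
  rw [endToEndSNR_eq_mul_relayGain]
  exact mul_pos h₁ (relayGain_pos hC h₂)

theorem hasPDF_endToEndSNR_hopSNR [IsFiniteMeasure P] (hI₁ : HasLaw I₁ (eggMeasure p₁) P)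
    (hI₂ : HasLaw I₂ (eggMeasure p₂) P) (hind : IndepFun I₁ I₂ P) (hη : 0 < η) (hN₁ : 0 < N₁)
    (hN₂ : 0 < N₂) (hr₁ : r₁ ≠ 0) (hC : 0 ≤ C) :
    HasPDF (fun ω => endToEndSNR C (hopSNR η N₁ r₁ (I₁ ω)) (hopSNR η N₂ r₂ (I₂ ω))) P volume :=
  have := hasPDF_hopSNR hη hN₁ hr₁ hI₁
  hasPDF_endToEndSNR (aemeasurable_hopSNR_comp hI₂) (indepFun_hopSNR hind)
    (ae_hopSNR_pos hη hN₂ hI₂) hC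

theorem integral_endToEndSNR_hopSNR_rpow_eq_setIntegral_pdf [IsFiniteMeasure P]
    (hI₁ : HasLaw I₁ (eggMeasure p₁) P) (hI₂ : HasLaw I₂ (eggMeasure p₂) P)
    (hind : IndepFun I₁ I₂ P) (hη : 0 < η) (hN₁ : 0 < N₁) (hN₂ : 0 < N₂) (hr₁ : r₁ ≠ 0)
    (hC : 0 ≤ C) :
    ∫ ω, endToEndSNR C (hopSNR η N₁ r₁ (I₁ ω)) (hopSNR η N₂ r₂ (I₂ ω)) ^ ν ∂P =
      ∫ y in Set.Ioi 0, y ^ ν * (pdf (fun ω => endToEndSNR C (hopSNR η N₁ r₁ (I₁ ω))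
        (hopSNR η N₂ r₂ (I₂ ω))) P volume y).toReal := by
  have := hasPDF_endToEndSNR_hopSNR (r₂ := r₂) hI₁ hI₂ hind hη hN₁ hN₂ hr₁ hC
  have hpow : Measurable fun y : ℝ => y ^ ν := measurable_id.pow_const ν
  rw [integral_comp_eq_setIntegral_pdf (μ := volume) (f := fun y => y ^ ν) measurableSet_Ioi
    (ae_endToEndSNR_hopSNR_pos hI₁ hI₂ hη hN₁ hN₂ hC) hpow.aestronglyMeasurable]
  simp only [smul_eq_mul, mul_comm]

theorem integrable_endToEndSNR_hopSNR_rpow [IsFiniteMeasure P]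
    (hI₁ : HasLaw I₁ (eggMeasure p₁) P) (hI₂ : HasLaw I₂ (eggMeasure p₂) P)
    (hind : IndepFun I₁ I₂ P) (hη : 0 < η) (hN₁ : 0 < N₁) (hN₂ : 0 < N₂) (hC : 0 ≤ C)
    (hν : 0 ≤ ν) :
    Integrable
      (fun ω => endToEndSNR C (hopSNR η N₁ r₁ (I₁ ω)) (hopSNR η N₂ r₂ (I₂ ω)) ^ ν) P := by
  have hint : Integrable (fun x => hopSNR η N₁ r₁ x ^ ν) (P.map I₁) := by
    have := p₁.a_pos
    have := p₁.c_pos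
    rw [hI₁.map_eq]
    exact integrable_hopSNR_rpow hη hN₁ (by positivity) (by positivity)
  exact integrable_endToEndSNR_rpow (hint.comp_aemeasurable hI₁.aemeasurable)
    (aemeasurable_hopSNR_comp hI₂) (indepFun_hopSNR hind)
    ((ae_hopSNR_pos hη hN₁ hI₁).mono fun _ => le_of_lt)
    ((ae_hopSNR_pos hη hN₂ hI₂).mono fun _ => le_of_lt) hC hν

theorem integral_endToEndSNR_hopSNR_rpow
    (hI₁ : HasLaw I₁ (eggMeasure p₁) P) (hI₂ : HasLaw I₂ (eggMeasure p₂) P)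
    (hind : IndepFun I₁ I₂ P) (hη : 0 < η) (hN₁ : 0 < N₁) (hN₂ : 0 < N₂) (hC : 0 ≤ C) :
    ∫ ω, endToEndSNR C (hopSNR η N₁ r₁ (I₁ ω)) (hopSNR η N₂ r₂ (I₂ ω)) ^ ν ∂P =
      (∫ x, hopSNR η N₁ r₁ x ^ ν ∂eggMeasure p₁) *
        ∫ x, relayGain C (hopSNR η N₂ r₂ x) ^ ν ∂eggMeasure p₂ := by
  have hsnr : Measurable fun x => hopSNR η N₁ r₁ x ^ ν := measurable_hopSNR.pow_const ν
  have hgain : Measurable fun x => relayGain C (hopSNR η N₂ r₂ x) ^ ν :=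
    (measurable_relayGain.comp measurable_hopSNR).pow_const ν
  rw [← hI₁.integral_comp hsnr.aestronglyMeasurable,
    ← hI₂.integral_comp hgain.aestronglyMeasurable]
  exact integral_endToEndSNR_rpow (aemeasurable_hopSNR_comp hI₁) (aemeasurable_hopSNR_comp hI₂)
    (indepFun_hopSNR hind) ((ae_hopSNR_pos hη hN₁ hI₁).mono fun _ => le_of_lt)
    ((ae_hopSNR_pos hη hN₂ hI₂).mono fun _ => le_of_lt) hC

theorem ofReal_integral_endToEndSNR_hopSNR_rpow
    (hI₁ : HasLaw I₁ (eggMeasure p₁) P) (hI₂ : HasLaw I₂ (eggMeasure p₂) P)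
    (hind : IndepFun I₁ I₂ P) (hη : 0 < η) (hN₁ : 0 < N₁) (hN₂ : 0 < N₂) (hr₂ : r₂ ≠ 0)
    (hC : 0 < C) (hν : 0 < ν) :
    ((∫ ω, endToEndSNR C (hopSNR η N₁ r₁ (I₁ ω)) (hopSNR η N₂ r₂ (I₂ ω)) ^ ν ∂P : ℝ) : ℂ) =
      ((p₁.w * p₂.w / Real.Gamma ν * Real.Gamma (1 + r₁ * ν) *
            (p₁.lam ^ r₁ * electricalSNR η N₁ r₁) ^ ν +
          p₂.w * (1 - p₁.w) * (p₁.b ^ r₁ * electricalSNR η N₁ r₁) ^ ν /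
            (Real.Gamma p₁.a * Real.Gamma ν) * Real.Gamma (p₁.a + r₁ * ν / p₁.c) : ℝ) : ℂ) *
        foxH 2 1 ![((1 - ν : ℂ), (1 : ℝ))] ![((0 : ℂ), (1 : ℝ)), ((1 : ℂ), (r₂ : ℝ))]
          ((C / (p₂.lam ^ r₂ * electricalSNR η N₂ r₂) : ℝ) : ℂ) +
      ((p₁.w * (1 - p₂.w) * Real.Gamma (1 + r₁ * ν) *
            (p₁.lam ^ r₁ * electricalSNR η N₁ r₁) ^ ν / (Real.Gamma p₂.a * Real.Gamma ν) +
          (1 - p₁.w) * (1 - p₂.w) * (p₁.b ^ r₁ * electricalSNR η N₁ r₁) ^ ν /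
            (Real.Gamma p₁.a * Real.Gamma p₂.a * Real.Gamma ν) *
            Real.Gamma (p₁.a + r₁ / p₁.c * ν) : ℝ) : ℂ) *
        foxH 2 1 ![((1 - ν : ℂ), (1 : ℝ))]
          ![((0 : ℂ), (1 : ℝ)), ((p₂.a : ℂ), (r₂ / p₂.c : ℝ))]
          ((C / (p₂.b ^ r₂ * electricalSNR η N₂ r₂) : ℝ) : ℂ) := by
  have := p₁.a_pos
  have := p₁.c_pos
  rw [integral_endToEndSNR_hopSNR_rpow hI₁ hI₂ hind hη hN₁ hN₂ hC.le, Complex.ofReal_mul,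
    ofReal_integral_relayGain_hopSNR_rpow hη hN₂ hr₂ hC hν,
    integral_hopSNR_rpow hη hN₁ (by positivity) (by positivity), mul_div_right_comm (r₁ : ℝ)]
  push_cast
  ring

end Moments

theorem theorem3_general {Ω : Type*} [MeasurableSpace Ω] (P : Measure Ω) [IsProbabilityMeasure P]
    (I₁ I₂ : Ω → ℝ) (p₁ p₂ : EGGParams)
    (hI₁ : HasLaw I₁ (eggMeasure p₁) P) (hI₂ : HasLaw I₂ (eggMeasure p₂) P)
    (hind : IndepFun I₁ I₂ P)
    (r₁ r₂ : ℕ) (hr₁ : r₁ ≠ 0) (hr₂ : r₂ ≠ 0)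
    (η N₁ N₂ C : ℝ) (hη : 0 < η) (hN₁ : 0 < N₁) (hN₂ : 0 < N₂) (hC : 0 < C)
    (γ₁ γ₂ γ : Ω → ℝ)
    (hγ₁ : ∀ x, γ₁ x = hopSNR η N₁ r₁ (I₁ x)) (hγ₂ : ∀ x, γ₂ x = hopSNR η N₂ r₂ (I₂ x))
    (hγ : ∀ x, γ x = endToEndSNR C (γ₁ x) (γ₂ x))
    (μ₁ μ₂ : ℝ) (hμ₁ : μ₁ = electricalSNR η N₁ r₁) (hμ₂ : μ₂ = electricalSNR η N₂ r₂)
    (ν : ℝ) (hν : 0 < ν) :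
    IsAverageElectricalSNR p₁ r₁ (∫ x, I₁ x ∂P) (∫ x, γ₁ x ∂P) μ₁ ∧
    IsAverageElectricalSNR p₂ r₂ (∫ x, I₂ x ∂P) (∫ x, γ₂ x ∂P) μ₂ ∧
    HasPDF γ P volume ∧
    Integrable (fun x => γ x ^ ν) P ∧
    ∫ x, γ x ^ ν ∂P = ∫ y in Set.Ioi (0 : ℝ), y ^ ν * (pdf γ P volume y).toReal ∧
    FoxHWellDefined 2 1 ![((1 - ν : ℂ), (1 : ℝ))] ![((0 : ℂ), (1 : ℝ)), ((1 : ℂ), (r₂ : ℝ))]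
      ((C / (p₂.lam ^ r₂ * μ₂) : ℝ) : ℂ) ∧
    FoxHWellDefined 2 1 ![((1 - ν : ℂ), (1 : ℝ))]
      ![((0 : ℂ), (1 : ℝ)), ((p₂.a : ℂ), (r₂ / p₂.c : ℝ))]
      ((C / (p₂.b ^ r₂ * μ₂) : ℝ) : ℂ) ∧
    ((∫ x, γ x ^ ν ∂P : ℝ) : ℂ) =
      ((p₁.w * p₂.w / Real.Gamma ν * Real.Gamma (1 + r₁ * ν) * (p₁.lam ^ r₁ * μ₁) ^ ν +
          p₂.w * (1 - p₁.w) * (p₁.b ^ r₁ * μ₁) ^ ν / (Real.Gamma p₁.a * Real.Gamma ν) *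
            Real.Gamma (p₁.a + r₁ * ν / p₁.c) : ℝ) : ℂ) *
        foxH 2 1 ![((1 - ν : ℂ), (1 : ℝ))] ![((0 : ℂ), (1 : ℝ)), ((1 : ℂ), (r₂ : ℝ))]
          ((C / (p₂.lam ^ r₂ * μ₂) : ℝ) : ℂ) +
      ((p₁.w * (1 - p₂.w) * Real.Gamma (1 + r₁ * ν) * (p₁.lam ^ r₁ * μ₁) ^ ν /
            (Real.Gamma p₂.a * Real.Gamma ν) +
          (1 - p₁.w) * (1 - p₂.w) * (p₁.b ^ r₁ * μ₁) ^ ν /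
            (Real.Gamma p₁.a * Real.Gamma p₂.a * Real.Gamma ν) *
            Real.Gamma (p₁.a + r₁ / p₁.c * ν) : ℝ) : ℂ) *
        foxH 2 1 ![((1 - ν : ℂ), (1 : ℝ))]
          ![((0 : ℂ), (1 : ℝ)), ((p₂.a : ℂ), (r₂ / p₂.c : ℝ))]
          ((C / (p₂.b ^ r₂ * μ₂) : ℝ) : ℂ) := by
  obtain rfl : γ₁ = fun x => hopSNR η N₁ r₁ (I₁ x) := funext hγ₁
  obtain rfl : γ₂ = fun x => hopSNR η N₂ r₂ (I₂ x) := funext hγ₂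
  obtain rfl : γ = fun x => endToEndSNR C (hopSNR η N₁ r₁ (I₁ x)) (hopSNR η N₂ r₂ (I₂ x)) :=
    funext hγ
  subst hμ₁ hμ₂
  have hμ₂ := electricalSNR_pos (r := r₂) hη hN₂
  have hlam₂ := p₂.lam_pos
  have hb₂ := p₂.b_pos
  refine ⟨isAverageElectricalSNR_hopSNR hη hN₁ hI₁, isAverageElectricalSNR_hopSNR hη hN₂ hI₂,
    hasPDF_endToEndSNR_hopSNR hI₁ hI₂ hind hη hN₁ hN₂ hr₁ hC.le,
    integrable_endToEndSNR_hopSNR_rpow hI₁ hI₂ hind hη hN₁ hN₂ hC.le hν.le,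
    integral_endToEndSNR_hopSNR_rpow_eq_setIntegral_pdf hI₁ hI₂ hind hη hN₁ hN₂ hr₁ hC.le,
    foxHWellDefined_two_one zero_le_one (by positivity) (by simpa) (by positivity),
    foxHWellDefined_two_one p₂.a_pos.le (div_pos (by positivity) p₂.c_pos) (by simpa)
      (by positivity),
    ofReal_integral_endToEndSNR_hopSNR_rpow hI₁ hI₂ hind hη hN₁ hN₂ hr₂ hC hν⟩

theorem theorem3 {Ω : Type*} [MeasurableSpace Ω] (P : Measure Ω) [IsProbabilityMeasure P]
    (I₁ I₂ : Ω → ℝ) (p₁ p₂ : EGGParams)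
    (hI₁ : HasLaw I₁ (eggMeasure p₁) P) (hI₂ : HasLaw I₂ (eggMeasure p₂) P)
    (hind : IndepFun I₁ I₂ P)
    (r₁ r₂ : ℕ) (hr₁ : r₁ = 1 ∨ r₁ = 2) (hr₂ : r₂ = 1 ∨ r₂ = 2)
    (η N₁ N₂ C : ℝ) (hη : 0 < η) (hN₁ : 0 < N₁) (hN₂ : 0 < N₂) (hC : 0 < C)
    (γ₁ γ₂ γ : Ω → ℝ)
    (hγ₁ : ∀ x, γ₁ x = hopSNR η N₁ r₁ (I₁ x)) (hγ₂ : ∀ x, γ₂ x = hopSNR η N₂ r₂ (I₂ x))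
    (hγ : ∀ x, γ x = endToEndSNR C (γ₁ x) (γ₂ x))
    (μ₁ μ₂ : ℝ) (hμ₁ : μ₁ = electricalSNR η N₁ r₁) (hμ₂ : μ₂ = electricalSNR η N₂ r₂)
    (n : ℕ) (hn : 1 ≤ n) :
    IsAverageElectricalSNR p₁ r₁ (∫ x, I₁ x ∂P) (∫ x, γ₁ x ∂P) μ₁ ∧
    IsAverageElectricalSNR p₂ r₂ (∫ x, I₂ x ∂P) (∫ x, γ₂ x ∂P) μ₂ ∧
    HasPDF γ P volume ∧
    Integrable (fun x => γ x ^ n) P ∧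
    ∫ x, γ x ^ n ∂P = ∫ y in Set.Ioi (0 : ℝ), y ^ n * (pdf γ P volume y).toReal ∧
    FoxHWellDefined 2 1 ![((1 - n : ℂ), (1 : ℝ))] ![((0 : ℂ), (1 : ℝ)), ((1 : ℂ), (r₂ : ℝ))]
      ((C / (p₂.lam ^ r₂ * μ₂) : ℝ) : ℂ) ∧
    FoxHWellDefined 2 1 ![((1 - n : ℂ), (1 : ℝ))]
      ![((0 : ℂ), (1 : ℝ)), ((p₂.a : ℂ), (r₂ / p₂.c : ℝ))]
      ((C / (p₂.b ^ r₂ * μ₂) : ℝ) : ℂ) ∧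
    ((∫ x, γ x ^ n ∂P : ℝ) : ℂ) =
      ((p₁.w * p₂.w / Real.Gamma n * Real.Gamma (1 + r₁ * n) * (p₁.lam ^ r₁ * μ₁) ^ n +
          p₂.w * (1 - p₁.w) * (p₁.b ^ r₁ * μ₁) ^ n / (Real.Gamma p₁.a * Real.Gamma n) *
            Real.Gamma (p₁.a + r₁ * n / p₁.c) : ℝ) : ℂ) *
        foxH 2 1 ![((1 - n : ℂ), (1 : ℝ))] ![((0 : ℂ), (1 : ℝ)), ((1 : ℂ), (r₂ : ℝ))]
          ((C / (p₂.lam ^ r₂ * μ₂) : ℝ) : ℂ) +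
      ((p₁.w * (1 - p₂.w) * Real.Gamma (1 + r₁ * n) * (p₁.lam ^ r₁ * μ₁) ^ n /
            (Real.Gamma p₂.a * Real.Gamma n) +
          (1 - p₁.w) * (1 - p₂.w) * (p₁.b ^ r₁ * μ₁) ^ n /
            (Real.Gamma p₁.a * Real.Gamma p₂.a * Real.Gamma n) *
            Real.Gamma (p₁.a + r₁ / p₁.c * n) : ℝ) : ℂ) *
        foxH 2 1 ![((1 - n : ℂ), (1 : ℝ))]
          ![((0 : ℂ), (1 : ℝ)), ((p₂.a : ℂ), (r₂ / p₂.c : ℝ))]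
          ((C / (p₂.b ^ r₂ * μ₂) : ℝ) : ℂ) := by
  simpa only [Real.rpow_natCast, Complex.ofReal_natCast] using
    theorem3_general P I₁ I₂ p₁ p₂ hI₁ hI₂ hind r₁ r₂ (by lia) (by lia) η N₁ N₂ C hη hN₁ hN₂ hC
      γ₁ γ₂ γ hγ₁ hγ₂ hγ μ₁ μ₂ hμ₁ hμ₂ n (Nat.cast_pos.2 hn)
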